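/- Let $\mathbf{FdHilb}$ be the category of finite-dimensional complex Hilbert spaces and linear maps, with the tensor product as monoidal structure, monoidal unit $\mathbb{C}$, swap maps $\sigma$, and with $f^\dagger$ the Hilbert space adjoint of a linear map $f$. A commutative $\dagger$-Frobenius monoid in $\mathbf{FdHilb}$ is a triple $(H,m,u)$ consisting of a finite-dimensional complex Hilbert space $H$ and linear maps $m: H\otimes H\to H$, $u:\mathbb{C}\to H$ such that, with $\delta=m^\dagger: H\to H\otimes H$ and $\varepsilon=u^\dagger: H\to\mathbb{C}$, and up to the canonical associativity and unit isomorphisms of the tensor product, - $(H,m,u)$ is a monoid: $m\circ(m\otimes \mathrm{id}_H)=m\circ(\mathrm{id}_H\otimes m)$ and $m\circ(u\otimes \mathrm{id}_H)=\mathrm{id}_H=m\circ(\mathrm{id}_H\otimes u)$; - $(H,\delta,\varepsilon)$ is a comonoid: $(\delta\otimes \mathrm{id}_H)\circ\delta=(\mathrm{id}_H\otimes\delta)\circ\delta$ and $(\varepsilon\otimes \mathrm{id}_H)\circ\delta=\mathrm{id}_H=(\mathrm{id}_H\otimes\varepsilon)\circ\delta$; - the Frobenius condition holds: $(m\otimes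 \mathrm{id}_H)\circ(\mathrm{id}_H\otimes\delta)=\delta\circ m=(\mathrm{id}_H\otimes m)\circ(\delta\otimes \mathrm{id}_H)$; - it is commutative: $\sigma\circ\delta=\delta$. Consider the category whose objects are the commutative $\dagger$-Frobenius monoids in $\mathbf{FdHilb}$ and whose morphisms $(H,m,u)\to(H',m',u')$ are the linear maps $f:H\to H'$ that preserve comultiplication and counit, i.e. $\delta'\circ f=(f\otimes f)\circ\delta$ and $\varepsilon'\circ f=\varepsilon$, with the usual composition. This category is equivalent to the category $\mathbf{FinSet}$ of finite sets and functions. -/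

import Mathlib

open CategoryTheory
open scoped TensorProduct

universe u

noncomputable section

/-- `(H, m, u, δ, ε)` is a Frobenius monoid (in complex vector spaces with the tensor product and
monoidal unit `ℂ`): an internal monoid and an internal comonoid, related by the Frobenius
condition. The associativity and unit isomorphisms of the tensor product are written explicitly. -/
structure IsFrobeniusMonoid {H : Type u} [AddCommGroup H] [Module ℂ H]
    (m : H ⊗[ℂ] H →ₗ[ℂ] H) (u : ℂ →ₗ[ℂ] H)
    (δ : H →ₗ[ℂ] H ⊗[ℂ] H) (ε : H →ₗ[ℂ] ℂ) : Prop where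
  /-- `m ∘ (m ⊗ H) = m ∘ (H ⊗ m)` -/
  assoc : m ∘ₗ m.rTensor H = m ∘ₗ m.lTensor H ∘ₗ (TensorProduct.assoc ℂ H H H).toLinearMap
  /-- `m ∘ (u ⊗ H) = λ` -/
  unit_left : m ∘ₗ u.rTensor H = (TensorProduct.lid ℂ H).toLinearMap
  /-- `m ∘ (H ⊗ u) = ρ` -/
  unit_right : m ∘ₗ u.lTensor H = (TensorProduct.rid ℂ H).toLinearMap
  /-- `(δ ⊗ H) ∘ δ = (H ⊗ δ) ∘ δ` -/
  coassoc : (TensorProduct.assoc ℂ H H H).toLinearMap ∘ₗ δ.rTensor H ∘ₗ δ = δ.lTensor H ∘ₗ δ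
  /-- `(ε ⊗ H) ∘ δ = λ⁻¹` -/
  counit_left : ε.rTensor H ∘ₗ δ = (TensorProduct.lid ℂ H).symm.toLinearMap
  /-- `(H ⊗ ε) ∘ δ = ρ⁻¹` -/
  counit_right : ε.lTensor H ∘ₗ δ = (TensorProduct.rid ℂ H).symm.toLinearMap
  /-- `(m ⊗ H) ∘ (H ⊗ δ) = δ ∘ m` -/
  frobenius_left :
    m.rTensor H ∘ₗ (TensorProduct.assoc ℂ H H H).symm.toLinearMap ∘ₗ δ.lTensor H = δ ∘ₗ m
  /-- `(H ⊗ m) ∘ (δ ⊗ H) = δ ∘ m` -/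
  frobenius_right :
    m.lTensor H ∘ₗ (TensorProduct.assoc ℂ H H H).toLinearMap ∘ₗ δ.rTensor H = δ ∘ₗ m

/-- A commutative †-Frobenius monoid in the category of finite-dimensional complex Hilbert spaces
(a finite-dimensional inner product space is automatically complete). -/
structure CommDaggerFrobeniusMonoid where
  /-- The underlying Hilbert space. -/
  carrier : Type u
  [normedAddCommGroup : NormedAddCommGroup carrier]
  [innerProductSpace : InnerProductSpace ℂ carrier]
  [finiteDimensional : FiniteDimensional ℂ carrier]
  /-- The multiplication. -/
  mul : carrier ⊗[ℂ] carrier →ₗ[ℂ] carrier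
  /-- The unit. -/
  unit : ℂ →ₗ[ℂ] carrier
  isFrobeniusMonoid :
    IsFrobeniusMonoid mul unit (LinearMap.adjoint mul) (LinearMap.adjoint unit)
  /-- Commutativity: `σ ∘ m† = m†`, with `σ` the swap map. -/
  comm : (TensorProduct.comm ℂ carrier carrier).toLinearMap ∘ₗ LinearMap.adjoint mul =
    LinearMap.adjoint mul

namespace CommDaggerFrobeniusMonoid

attribute [instance] normedAddCommGroup innerProductSpace finiteDimensional

/-- The comultiplication `δ = m†`. -/
def comul (A : CommDaggerFrobeniusMonoid.{u}) : A.carrier →ₗ[ℂ] A.carrier ⊗[ℂ] A.carrier :=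
  LinearMap.adjoint A.mul

/-- The counit `ε = u†`. -/
def counit (A : CommDaggerFrobeniusMonoid.{u}) : A.carrier →ₗ[ℂ] ℂ :=
  LinearMap.adjoint A.unit

/-- Linear maps that preserve comultiplication and counit. -/
@[ext]
structure Hom (A B : CommDaggerFrobeniusMonoid.{u}) where
  /-- The underlying linear map. -/
  toLinearMap : A.carrier →ₗ[ℂ] B.carrier
  comul_comp : B.comul ∘ₗ toLinearMap = TensorProduct.map toLinearMap toLinearMap ∘ₗ A.comul
  counit_comp : B.counit ∘ₗ toLinearMap = A.counit

/-- The category of commutative †-Frobenius monoids and linear maps preserving comultiplication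
and counit. -/
instance : Category CommDaggerFrobeniusMonoid.{u} where
  Hom := Hom
  id A :=
    { toLinearMap := LinearMap.id
      comul_comp := by simp [TensorProduct.map_id]
      counit_comp := by simp }
  comp f g :=
    { toLinearMap := g.toLinearMap ∘ₗ f.toLinearMap
      comul_comp := by
        rw [← LinearMap.comp_assoc, g.comul_comp, LinearMap.comp_assoc, f.comul_comp,
          ← LinearMap.comp_assoc, ← TensorProduct.map_comp]
      counit_comp := by
        rw [← LinearMap.comp_assoc, g.counit_comp, f.counit_comp] }
  id_comp _ := rfl
  comp_id _ := rfl
  assoc _ _ _ := rfl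

end CommDaggerFrobeniusMonoid

end

/-!
An orthonormal basis `b` of a Hilbert space determines a commutative †-Frobenius monoid: its
comultiplication copies the basis vectors, `b i ↦ b i ⊗ b i`, its counit deletes them, and its
multiplication, the adjoint of the comultiplication, makes them orthogonal idempotents. For the
standard basis of `ℂ ^ X` this gives a functor `freeFunctor` from finite sets to commutative
†-Frobenius monoids, which is shown to be an equivalence.

It is full because a morphism maps copyable vectors (`δ v = v ⊗ v`, `ε v = 1`) to copyable vectors,
and the copyable vectors of `ℂ ^ X` are just the basis vectors (`exists_eq_of_copyable`).

It is essentially surjective because of the structure of the algebra `A` underlying a commutative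
†-Frobenius monoid. The Frobenius condition says that the adjoint of a multiplication operator is
again a multiplication operator (`exists_adjoint_element`). The multiplication operators thus
commute and are normal, so none of them is nilpotent except zero, and `A` is reduced (`isReduced`).
A reduced finite-dimensional commutative `ℂ`-algebra is isomorphic to some `ℂ ^ X`
(`exists_algEquiv_pi`), and the adjoint of an isomorphism of algebras preserves comultiplication and
counit (`isoOfAdjoint`). The isomorphism need not be unitary: the copyable vectors of `A` are
orthogonal, but may have any norms.
-/

noncomputable section

namespace CommDaggerFrobeniusMonoid

/-! ### The †-Frobenius monoid of an orthonormal basis -/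

section Basis

variable {ι : Type*} [Fintype ι] {E : Type*} [NormedAddCommGroup E] [InnerProductSpace ℂ E]

open Classical in
/-- The multiplication for which the vectors of `b` are orthogonal idempotents. -/
def basisMul (b : OrthonormalBasis ι ℂ E) : E ⊗[ℂ] E →ₗ[ℂ] E :=
  (b.toBasis.tensorProduct b.toBasis).constr ℂ fun p => if p.1 = p.2 then b p.1 else 0

/-- The unit of `basisMul b`: the sum of the idempotents. -/
def basisUnit (b : OrthonormalBasis ι ℂ E) : ℂ →ₗ[ℂ] E :=
  LinearMap.toSpanSingleton ℂ E (∑ i, b i)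

/-- The comultiplication that copies the vectors of `b`. -/
def basisComul (b : OrthonormalBasis ι ℂ E) : E →ₗ[ℂ] E ⊗[ℂ] E :=
  b.toBasis.constr ℂ fun i => b i ⊗ₜ b i

/-- The counit that deletes the vectors of `b`. -/
def basisCounit (b : OrthonormalBasis ι ℂ E) : E →ₗ[ℂ] ℂ :=
  b.toBasis.constr ℂ fun _ => (1 : ℂ)

variable (b : OrthonormalBasis ι ℂ E)

lemma constr_orthonormalBasis {M : Type*} [AddCommGroup M] [Module ℂ M] (f : ι → M) (i : ι) :
    b.toBasis.constr ℂ f (b i) = f i := by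
  have := b.toBasis.constr_basis ℂ f i
  rwa [b.coe_toBasis] at this

open Classical in
@[simp]
lemma basisMul_tmul (i j : ι) : basisMul b (b i ⊗ₜ b j) = if i = j then b i else 0 := by
  have := (b.toBasis.tensorProduct b.toBasis).constr_basis ℂ
    (fun p : ι × ι => if p.1 = p.2 then b p.1 else 0) (i, j)
  simpa [basisMul, Module.Basis.tensorProduct_apply] using this

@[simp]
lemma basisUnit_apply (c : ℂ) : basisUnit b c = c • ∑ i, b i := rfl

@[simp]
lemma basisComul_apply (i : ι) : basisComul b (b i) = b i ⊗ₜ b i := by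
  rw [basisComul, constr_orthonormalBasis]

@[simp]
lemma basisCounit_apply (i : ι) : basisCounit b (b i) = 1 := by
  rw [basisCounit, constr_orthonormalBasis]

lemma ext_orthonormalBasis {M : Type*} [AddCommGroup M] [Module ℂ M] {f g : E →ₗ[ℂ] M}
    (h : ∀ i, f (b i) = g (b i)) : f = g :=
  b.toBasis.ext (by simpa using h)

lemma ext_orthonormalBasis₂ {M : Type*} [AddCommGroup M] [Module ℂ M] {f g : E ⊗[ℂ] E →ₗ[ℂ] M}
    (h : ∀ i j, f (b i ⊗ₜ b j) = g (b i ⊗ₜ b j)) : f = g :=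
  TensorProduct.ext <| ext_orthonormalBasis b fun i => ext_orthonormalBasis b fun j => h i j

lemma ext_orthonormalBasis₃ {M : Type*} [AddCommGroup M] [Module ℂ M]
    {f g : (E ⊗[ℂ] E) ⊗[ℂ] E →ₗ[ℂ] M}
    (h : ∀ i j k, f ((b i ⊗ₜ b j) ⊗ₜ b k) = g ((b i ⊗ₜ b j) ⊗ₜ b k)) : f = g :=
  TensorProduct.ext <| ext_orthonormalBasis₂ b fun i j => ext_orthonormalBasis b fun k => h i j k

lemma adjoint_basisMul [FiniteDimensional ℂ E] :
    LinearMap.adjoint (basisMul b) = basisComul b := by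
  classical
  symm
  rw [LinearMap.eq_adjoint_iff_basis b.toBasis (b.toBasis.tensorProduct b.toBasis)]
  rintro i ⟨j, k⟩
  simp only [OrthonormalBasis.coe_toBasis, basisComul_apply, Module.Basis.tensorProduct_apply,
    TensorProduct.inner_tmul, basisMul_tmul, OrthonormalBasis.inner_eq_ite]
  split_ifs <;> simp_all

lemma adjoint_basisUnit [FiniteDimensional ℂ E] :
    LinearMap.adjoint (basisUnit b) = basisCounit b := by
  classical
  symm
  rw [LinearMap.eq_adjoint_iff]
  intro x c
  revert x
  suffices h : (innerₛₗ ℂ (E := ℂ)).flip c ∘ₛₗ basisCounit b =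
      (innerₛₗ ℂ (E := E)).flip (basisUnit b c) from fun x => LinearMap.congr_fun h x
  refine b.toBasis.ext fun i => ?_
  simp [OrthonormalBasis.inner_eq_ite]

lemma basisComul_comm :
    (TensorProduct.comm ℂ E E).toLinearMap ∘ₗ basisComul b = basisComul b :=
  ext_orthonormalBasis b fun i => by simp

lemma isFrobeniusMonoid_basis :
    IsFrobeniusMonoid (basisMul b) (basisUnit b) (basisComul b) (basisCounit b) := by
  classical
  constructor
  · refine ext_orthonormalBasis₃ b fun i j k => ?_
    simp only [LinearMap.comp_apply, LinearMap.rTensor_tmul, LinearMap.lTensor_tmul,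
      LinearEquiv.coe_coe, TensorProduct.assoc_tmul, basisMul_tmul]
    split_ifs <;> simp_all
  · refine TensorProduct.ext (LinearMap.ext_ring (ext_orthonormalBasis b fun i => ?_))
    simp [TensorProduct.sum_tmul]
  · refine TensorProduct.ext (ext_orthonormalBasis b fun i => LinearMap.ext_ring ?_)
    simp [TensorProduct.tmul_sum]
  · exact ext_orthonormalBasis b fun i => by simp
  · exact ext_orthonormalBasis b fun i => by simp
  · exact ext_orthonormalBasis b fun i => by simp
  · refine ext_orthonormalBasis₂ b fun i j => ?_
    simp only [LinearMap.comp_apply, LinearMap.rTensor_tmul, LinearMap.lTensor_tmul,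
      LinearEquiv.coe_coe, TensorProduct.assoc_symm_tmul, basisMul_tmul, basisComul_apply]
    split_ifs <;> simp_all
  · refine ext_orthonormalBasis₂ b fun i j => ?_
    simp only [LinearMap.comp_apply, LinearMap.rTensor_tmul, LinearMap.lTensor_tmul,
      LinearEquiv.coe_coe, TensorProduct.assoc_tmul, basisMul_tmul, basisComul_apply]
    split_ifs <;> simp_all

/-- The only vectors that are copied by `basisComul b` and deleted by `basisCounit b` are those
of `b`: the coordinates of such a vector are orthogonal idempotents of `ℂ` with sum `1`. -/
lemma exists_eq_of_copyable {v : E} (hδ : basisComul b v = v ⊗ₜ v) (hε : basisCounit b v = 1) :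
    ∃ i, v = b i := by
  classical
  have : FiniteDimensional ℂ E := b.toBasis.finiteDimensional_of_finite
  have hcoord (i j : ι) : (if i = j then inner ℂ (b i) v else 0) =
      inner ℂ (b i) v * inner ℂ (b j) v := by
    rw [← TensorProduct.inner_tmul, ← hδ, ← adjoint_basisMul, LinearMap.adjoint_inner_right,
      basisMul_tmul]
    split_ifs <;> simp
  have hsum : ∑ i, inner ℂ (b i) v = 1 := by
    rw [← hε, ← adjoint_basisUnit]
    have := LinearMap.adjoint_inner_right (basisUnit b) 1 v
    simpa [sum_inner] using this.symm
  obtain ⟨i, -, hi⟩ := Finset.exists_ne_zero_of_sum_ne_zero (hsum.trans_ne one_ne_zero)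
  refine ⟨i, ?_⟩
  have hi1 : inner ℂ (b i) v = 1 := by
    have := hcoord i i
    rw [if_pos rfl] at this
    exact (mul_eq_left₀ hi).1 this.symm
  rw [← b.sum_repr' v, Finset.sum_eq_single i, hi1, one_smul]
  · intro j _ hj
    have := hcoord i j
    rw [if_neg hj.symm, hi1, one_mul] at this
    rw [← this, zero_smul]
  · simp

end Basis

/-! ### Adjoints of monoid homomorphisms -/

/-- The adjoint of a linear map that preserves multiplication and unit is a morphism. -/
def homOfAdjoint {A B : CommDaggerFrobeniusMonoid.{u}} (g : B.carrier →ₗ[ℂ] A.carrier)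
    (hmul : g ∘ₗ B.mul = A.mul ∘ₗ TensorProduct.map g g) (hunit : g ∘ₗ B.unit = A.unit) :
    A ⟶ B where
  toLinearMap := LinearMap.adjoint g
  comul_comp := by
    rw [comul, comul, ← LinearMap.adjoint_comp, hmul, LinearMap.adjoint_comp,
      TensorProduct.adjoint_map]
  counit_comp := by
    rw [counit, counit, ← LinearMap.adjoint_comp, hunit]

/-- An isomorphism of monoids has as adjoint an isomorphism of comonoids. -/
def isoOfAdjoint {A B : CommDaggerFrobeniusMonoid.{u}} (e : B.carrier ≃ₗ[ℂ] A.carrier)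
    (hmul : ∀ x y, e (B.mul (x ⊗ₜ y)) = A.mul (e x ⊗ₜ e y)) (hunit : e (B.unit 1) = A.unit 1) :
    A ≅ B where
  hom := homOfAdjoint e.toLinearMap (TensorProduct.ext' (by simpa using hmul))
    (LinearMap.ext_ring (by simpa using hunit))
  inv := homOfAdjoint e.symm.toLinearMap
    (TensorProduct.ext' fun x y => by
      simpa using e.symm_apply_eq.2 (by simp [hmul]))
    (LinearMap.ext_ring (by simpa using e.symm_apply_eq.2 hunit.symm))
  hom_inv_id := Hom.ext <| by
    change LinearMap.adjoint e.symm.toLinearMap ∘ₗ LinearMap.adjoint e.toLinearMap = LinearMap.id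
    rw [← LinearMap.adjoint_comp]; simp
  inv_hom_id := Hom.ext <| by
    change LinearMap.adjoint e.toLinearMap ∘ₗ LinearMap.adjoint e.symm.toLinearMap = LinearMap.id
    rw [← LinearMap.adjoint_comp]; simp

/-! ### The underlying algebra -/

section Algebra

variable (A : CommDaggerFrobeniusMonoid.{u})

lemma comul_eq : A.comul = LinearMap.adjoint A.mul := rfl

lemma mul_comm_apply (x y : A.carrier) : A.mul (x ⊗ₜ y) = A.mul (y ⊗ₜ x) := by
  refine ext_inner_left ℂ fun z => ?_
  rw [← LinearMap.adjoint_inner_left, ← LinearMap.adjoint_inner_left]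
  conv_lhs => rw [← A.comm]
  have := TensorProduct.inner_comm_comm (𝕜 := ℂ) (LinearMap.adjoint A.mul z) (y ⊗ₜ[ℂ] x)
  simpa using this

/-- The commutative ring structure on the carrier given by the internal monoid. It extends the
additive group of the Hilbert space and is not an instance, since a carrier may already bear a
product of its own. -/
@[reducible]
def commRing : CommRing A.carrier :=
  { (inferInstance : AddCommGroup A.carrier) with
    mul := fun x y => A.mul (x ⊗ₜ y)
    one := A.unit 1
    left_distrib := fun x y z => by
      change A.mul _ = A.mul _ + A.mul _
      rw [TensorProduct.tmul_add, map_add]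
    right_distrib := fun x y z => by
      change A.mul _ = A.mul _ + A.mul _
      rw [TensorProduct.add_tmul, map_add]
    zero_mul := fun x => by
      change A.mul _ = _
      rw [TensorProduct.zero_tmul, map_zero]
    mul_zero := fun x => by
      change A.mul _ = _
      rw [TensorProduct.tmul_zero, map_zero]
    mul_assoc := fun x y z => by
      change A.mul (A.mul _ ⊗ₜ _) = A.mul (_ ⊗ₜ A.mul _)
      simpa using LinearMap.congr_fun A.isFrobeniusMonoid.assoc ((x ⊗ₜ y) ⊗ₜ z)
    one_mul := fun x => by
      change A.mul (A.unit 1 ⊗ₜ x) = x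
      simpa using LinearMap.congr_fun A.isFrobeniusMonoid.unit_left (1 ⊗ₜ x)
    mul_one := fun x => by
      change A.mul (x ⊗ₜ A.unit 1) = x
      simpa using LinearMap.congr_fun A.isFrobeniusMonoid.unit_right (x ⊗ₜ 1)
    mul_comm := fun x y => A.mul_comm_apply x y }

/-- The `ℂ`-algebra structure on the carrier given by the internal monoid. -/
@[reducible]
def algebra : @Algebra ℂ A.carrier _ A.commRing.toCommSemiring.toSemiring :=
  letI := A.commRing
  Algebra.ofModule
    (fun c x y => by
      change A.mul _ = c • A.mul _
      rw [← TensorProduct.smul_tmul', map_smul])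
    (fun c x y => by
      change A.mul _ = c • A.mul _
      rw [TensorProduct.tmul_smul, map_smul])

/-- By the Frobenius condition, the adjoint of multiplication by `a` commutes with multiplication
from the right; hence it is itself multiplication by an element, the image of the unit. -/
lemma exists_adjoint_element (a : A.carrier) :
    ∃ a' : A.carrier, ∀ x y,
      inner ℂ (A.mul (a' ⊗ₜ x)) y = inner ℂ x (A.mul (a ⊗ₜ y)) := by
  -- contraction of the first tensor factor with `a`
  let K : A.carrier ⊗[ℂ] A.carrier →ₗ[ℂ] A.carrier :=
    (TensorProduct.lid ℂ A.carrier).toLinearMap ∘ₗ (innerₛₗ ℂ a).rTensor A.carrier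
  have hK : ∀ t y, inner ℂ (K t) y = inner ℂ t (a ⊗ₜ[ℂ] y) := by
    intro t y
    induction t with
    | zero => simp
    | add s t hs ht => simp [inner_add_left, hs, ht]
    | tmul x z => simp [K, mul_comm]
  have hKm : K ∘ₗ A.mul.lTensor A.carrier ∘ₗ
      (TensorProduct.assoc ℂ A.carrier A.carrier A.carrier).toLinearMap =
      A.mul ∘ₗ K.rTensor A.carrier := by
    refine TensorProduct.ext_threefold fun x y z => ?_
    simp [K, ← TensorProduct.smul_tmul']
  refine ⟨K (A.comul (A.unit 1)), fun x y => ?_⟩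
  have h1 := LinearMap.congr_fun hKm (A.comul (A.unit 1) ⊗ₜ x)
  have h2 := LinearMap.congr_fun A.isFrobeniusMonoid.frobenius_right (A.unit 1 ⊗ₜ x)
  have h3 : A.mul (A.unit 1 ⊗ₜ x) = x := by
    simpa using LinearMap.congr_fun A.isFrobeniusMonoid.unit_left (1 ⊗ₜ x)
  simp only [LinearMap.comp_apply, LinearMap.rTensor_tmul, LinearEquiv.coe_coe, h3] at h1 h2
  rw [← h1, comul_eq, h2, hK, LinearMap.adjoint_inner_left]

/-- If `a ^ 2 = 0`, then `h = a' * a`, with `a'` the adjoint element, satisfies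
`‖h‖ ^ 2 = ⟪a, a * h⟫ = 0`, and then `‖a‖ ^ 2 = ⟪1, h⟫ = 0`. -/
lemma isReduced : @IsReduced A.carrier _ A.commRing.toMonoidWithZero.toMonoid.toPow := by
  let := A.commRing
  have key : ∀ a : A.carrier, a * a = 0 → a = 0 := by
    intro a ha
    obtain ⟨a', h⟩ := A.exists_adjoint_element a
    replace h : ∀ x y : A.carrier, inner ℂ (a' * x) y = inner ℂ x (a * y) := h
    have h0 : a' * a = 0 := by
      rw [← inner_self_eq_zero (𝕜 := ℂ), h, mul_left_comm, ha, mul_zero, inner_zero_right]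
    rw [← inner_self_eq_zero (𝕜 := ℂ)]
    have := h a 1
    rw [h0, mul_one, inner_zero_left] at this
    exact this.symm
  exact (isReduced_iff_pow_one_lt 2 one_lt_two).2 fun a ha => key a (by rwa [← sq])

end Algebra

/-- A reduced finite-dimensional commutative algebra over an algebraically closed field is a finite
power of the field: it is Artinian, so a product of its residue fields, which are finite extensions
of the base field. -/
lemma exists_algEquiv_pi (k R : Type*) [Field k] [IsAlgClosed k] [CommRing R] [Algebra k R]
    [FiniteDimensional k R] [IsReduced R] :
    Nonempty (R ≃ₐ[k] (MaximalSpectrum R → k)) := by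
  have : IsArtinianRing R := IsArtinianRing.of_finite k R
  have hbij (I : MaximalSpectrum R) : Function.Bijective (algebraMap k (R ⧸ I.asIdeal)) := by
    have := I.isMaximal
    exact IsAlgClosed.algebraMap_bijective_of_isIntegral
  exact ⟨((IsArtinianRing.equivPi R).restrictScalars k).trans
    (AlgEquiv.piCongrRight fun I => (AlgEquiv.ofBijective (Algebra.ofId k _) (hbij I)).symm)⟩

/-! ### The equivalence with finite sets -/

section Equivalence

/-- The standard orthonormal basis of `ℂ ^ X`, for `X` in `FintypeCat`. -/
abbrev stdBasis (X : FintypeCat.{u}) :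
    letI := X.fintype
    OrthonormalBasis X.obj ℂ (EuclideanSpace ℂ X.obj) :=
  letI := X.fintype
  EuclideanSpace.basisFun X.obj ℂ

/-- The Hilbert space `ℂ ^ X`, with the comultiplication and counit that copy and delete the
standard basis vectors. -/
def free (X : FintypeCat.{u}) : CommDaggerFrobeniusMonoid.{u} :=
  letI := X.fintype
  { carrier := EuclideanSpace ℂ X.obj
    mul := basisMul (stdBasis X)
    unit := basisUnit (stdBasis X)
    isFrobeniusMonoid := by
      rw [adjoint_basisMul, adjoint_basisUnit]
      exact isFrobeniusMonoid_basis _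
    comm := by
      rw [adjoint_basisMul]
      exact basisComul_comm _ }

/-- The basis of `free X` that is copied by the comultiplication. -/
def freeBasis (X : FintypeCat.{u}) :
    letI := X.fintype
    OrthonormalBasis X.obj ℂ (free X).carrier :=
  stdBasis X

variable {X Y : FintypeCat.{u}}

lemma free_mul : letI := X.fintype; (free X).mul = basisMul (freeBasis X) := rfl

lemma free_unit : letI := X.fintype; (free X).unit = basisUnit (freeBasis X) := rfl

lemma free_comul : letI := X.fintype; (free X).comul = basisComul (freeBasis X) :=
  letI := X.fintype
  adjoint_basisMul (freeBasis X)

lemma free_counit : letI := X.fintype; (free X).counit = basisCounit (freeBasis X) :=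
  letI := X.fintype
  adjoint_basisUnit (freeBasis X)

/-- Morphisms out of `free X` are determined by the images of the basis vectors. -/
lemma free_hom_ext {A : CommDaggerFrobeniusMonoid.{u}} {f g : free X ⟶ A}
    (h : ∀ x, f.toLinearMap (freeBasis X x) = g.toLinearMap (freeBasis X x)) : f = g :=
  letI := X.fintype
  Hom.ext (ext_orthonormalBasis (freeBasis X) h)

/-- The linear extension of a function `X → Y` to a morphism `free X ⟶ free Y`. -/
def freeMap (f : X → Y) : free X ⟶ free Y :=
  letI := X.fintype
  letI := Y.fintype
  have hf (x : X) : (freeBasis X).toBasis.constr ℂ (fun x => freeBasis Y (f x)) (freeBasis X x) =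
      freeBasis Y (f x) :=
    constr_orthonormalBasis _ _ x
  { toLinearMap := (freeBasis X).toBasis.constr ℂ fun x => freeBasis Y (f x)
    comul_comp := by
      rw [free_comul, free_comul]
      exact ext_orthonormalBasis (freeBasis X) fun x => by simp [hf]
    counit_comp := by
      rw [free_counit, free_counit]
      exact ext_orthonormalBasis (freeBasis X) fun x => by simp [hf] }

@[simp]
lemma freeMap_basis (f : X → Y) (x : X) :
    (freeMap f).toLinearMap (freeBasis X x) = freeBasis Y (f x) :=
  letI := X.fintype
  letI := Y.fintype
  constr_orthonormalBasis (freeBasis X) _ x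

variable (X) in
lemma freeBasis_injective : Function.Injective (freeBasis X) :=
  letI := X.fintype
  (freeBasis X).orthonormal.linearIndependent.injective

/-- A morphism maps the copied basis of `free X` to copyable vectors of `free Y`, that is, to
vectors of the copied basis of `free Y`. -/
lemma exists_freeMap_eq (g : free X ⟶ free Y) : ∃ f : X ⟶ Y, freeMap f = g := by
  let := X.fintype
  let := Y.fintype
  have hg (x : X) : ∃ y, g.toLinearMap (freeBasis X x) = freeBasis Y y := by
    refine exists_eq_of_copyable (freeBasis Y) ?_ ?_
    · rw [← free_comul]
      refine (LinearMap.congr_fun g.comul_comp _).trans ?_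
      rw [free_comul]
      simp
    · rw [← free_counit]
      refine (LinearMap.congr_fun g.counit_comp _).trans ?_
      rw [free_counit]
      simp
  choose f hf using hg
  exact ⟨FintypeCat.homMk f, free_hom_ext fun x => (freeMap_basis f x).trans (hf x).symm⟩

variable (X) in
/-- The coordinates of the vectors of `free X`. -/
def freeCoord : (free X).carrier ≃ₗ[ℂ] (X → ℂ) :=
  WithLp.linearEquiv 2 ℂ (X → ℂ)

open Classical in
lemma freeCoord_basis (x : X) : freeCoord X (freeBasis X x) = Pi.single x 1 := by
  let := X.fintype
  change WithLp.ofLp (EuclideanSpace.basisFun X.obj ℂ x) = _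
  rw [EuclideanSpace.basisFun_apply]
  simp

/-- The multiplication of `free X` is the pointwise one. -/
lemma freeCoord_mul (v w : (free X).carrier) :
    freeCoord X ((free X).mul (v ⊗ₜ w)) = freeCoord X v * freeCoord X w := by
  classical
  let := X.fintype
  suffices h : (freeCoord X).toLinearMap ∘ₗ (free X).mul =
      LinearMap.mul' ℂ (X → ℂ) ∘ₗ
        TensorProduct.map (freeCoord X).toLinearMap (freeCoord X).toLinearMap by
    simpa using LinearMap.congr_fun h (v ⊗ₜ w)
  refine ext_orthonormalBasis₂ (freeBasis X) fun x y => ?_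
  rw [free_mul]
  simp only [LinearMap.comp_apply, LinearEquiv.coe_coe, TensorProduct.map_tmul, basisMul_tmul,
    freeCoord_basis, LinearMap.mul'_apply]
  split_ifs with h
  · subst h
    rw [freeCoord_basis, ← Pi.single_mul, one_mul]
  · ext z
    by_cases hz : z = x <;> simp_all

lemma freeCoord_unit : freeCoord X ((free X).unit 1) = 1 := by
  classical
  let := X.fintype
  rw [free_unit, basisUnit_apply, one_smul, map_sum]
  ext x
  simp [freeCoord_basis]

/-- The functor `X ↦ ℂ ^ X` from finite sets to commutative †-Frobenius monoids. -/
def freeFunctor : FintypeCat.{u} ⥤ CommDaggerFrobeniusMonoid.{u} where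
  obj := free
  map f := freeMap f
  map_id X := free_hom_ext fun x => freeMap_basis _ x
  map_comp f g := free_hom_ext fun x => by
    refine (freeMap_basis _ x).trans ?_
    change _ = (freeMap g).toLinearMap ((freeMap f).toLinearMap _)
    rw [freeMap_basis, freeMap_basis]
    rfl

instance : freeFunctor.{u}.Faithful where
  map_injective {X Y f g} h := by
    ext x
    refine freeBasis_injective Y ?_
    rw [← freeMap_basis, ← freeMap_basis]
    exact congrArg (fun k : free X ⟶ free Y => k.toLinearMap (freeBasis X x)) h

instance : freeFunctor.{u}.Full where
  map_surjective := exists_freeMap_eq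

/-- The underlying algebra of a commutative †-Frobenius monoid is isomorphic to some `ℂ ^ X`; the
adjoint of such an isomorphism is an isomorphism of comonoids. -/
instance : freeFunctor.{u}.EssSurj where
  mem_essImage A := by
    let := A.commRing
    let := A.algebra
    have := A.isReduced
    have : FiniteDimensional ℂ A.carrier := A.finiteDimensional
    have : IsArtinianRing A.carrier := IsArtinianRing.of_finite ℂ A.carrier
    obtain ⟨e⟩ := exists_algEquiv_pi ℂ A.carrier
    let X : FintypeCat.{u} := FintypeCat.of (MaximalSpectrum A.carrier)
    let e' : (free X).carrier ≃ₗ[ℂ] A.carrier :=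
      (freeCoord X).trans e.symm.toLinearEquiv
    refine ⟨X, ⟨(isoOfAdjoint e' (fun v w => ?_) ?_).symm⟩⟩
    · change e.symm (freeCoord X _) = e.symm (freeCoord X v) * e.symm (freeCoord X w)
      rw [freeCoord_mul, map_mul]
    · change e.symm (freeCoord X _) = (1 : A.carrier)
      rw [freeCoord_unit, map_one]

end Equivalence

end CommDaggerFrobeniusMonoid

end

/-- The category of commutative †-Frobenius monoids in finite-dimensional Hilbert spaces, with
morphisms the linear maps preserving comultiplication and counit, is equivalent to the category of
finite sets and functions. -/
theorem mainTheorem5 : Nonempty (CommDaggerFrobeniusMonoid.{u} ≌ FintypeCat.{u}) := by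
  have : CommDaggerFrobeniusMonoid.freeFunctor.{u}.IsEquivalence := { }
  exact ⟨CommDaggerFrobeniusMonoid.freeFunctor.asEquivalence.symm⟩
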